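/- Let $U\subset\mathbb{R}^n$ be an open convex set, let $f\colon U\to\mathbb{R}$ be convex, and let $(x_k)_{k\ge 0}$ be a sequence in $U$ that is a BFGS sequence for $f$. This means: $f$ is differentiable at each $x_k$ with $\nabla f(x_k)\neq 0$, and there exist parameters $0<\mu<\nu<1$ and a positive definite $n\times n$ matrix $H_0$ such that the vectors $s_k=x_{k+1}-x_k$, $y_k=\nabla f(x_{k+1})-\nabla f(x_k)$ and the matrices defined recursively by $$V_k=I-\frac{s_ky_k^T}{s_k^Ty_k},\qquad H_{k+1}=V_kH_kV_k^T+\frac{s_ks_k^T}{s_k^Ty_k}$$ satisfy, for all $k=0,1,2,\dots$, $$H_k\nabla f(x_k)\in-\mathbb{R}_+s_k,\qquad f(x_{k+1})\le f(x_k)+\mu\nabla f(x_k)^Ts_k,\qquad \nabla f(x_{k+1})^Ts_k\ge\nu\nabla f(x_k)^Ts_k .$$ Assume that the level set $\{x\in U: f(x)\le f(x_0)\}$ is bounded. Assume also that there is an open set $V\subset U$ that contains the closure in $\mathbb{R}^n$ of the set $\{x_k:k\ge 0\}$, satisfies $\inf_V f=\inf_U f>-\infty$, and has the following property: for every $\delta>0$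 there are a convex open set $U_\delta\subset U$ with $\{x\in U: f(x)\le f(x_0)\}\subset U_\delta$ and a $C^{2}$ convex function $f_\delta\colon U_\delta\to\mathbb{R}$ with $f_\delta(x)=f(x)$ for all $x\in U_\delta$ such that $d_{V^c}(x)>\delta$. Here $V^c=\mathbb{R}^n\setminus V$, and $d_{V^c}(x)$ is the Euclidean distance from $x$ to $V^c$, equal to $+\infty$ if $V^c=\emptyset$. Then $f$ attains its minimum over $U$, and $f(x_k)\to\min_U f$ as $k\to\infty$. -/

import Mathlib

open Matrix

/-- The BFGS update of the approximate inverse Hessian `H` for the step `s` and the gradient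
increment `y`: with `V = I - s yᵀ / (sᵀ y)`, it is `V H Vᵀ + s sᵀ / (sᵀ y)`. -/
noncomputable def bfgsUpdate {n : ℕ} (H : Matrix (Fin n) (Fin n) ℝ)
    (s y : EuclideanSpace ℝ (Fin n)) : Matrix (Fin n) (Fin n) ℝ :=
  (1 - (inner ℝ s y)⁻¹ • vecMulVec s.ofLp y.ofLp) * H *
      (1 - (inner ℝ s y)⁻¹ • vecMulVec s.ofLp y.ofLp)ᵀ +
    (inner ℝ s y)⁻¹ • vecMulVec s.ofLp s.ofLp

/-- The matrices `H₀, H₁, H₂, …` generated from `H₀` by the BFGS updates along the points `x k`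
at which the gradients are `g k`. -/
noncomputable def bfgsMatrix {n : ℕ} (H₀ : Matrix (Fin n) (Fin n) ℝ)
    (x g : ℕ → EuclideanSpace ℝ (Fin n)) : ℕ → Matrix (Fin n) (Fin n) ℝ
  | 0 => H₀
  | k + 1 => bfgsUpdate (bfgsMatrix H₀ x g k) (x (k + 1) - x k) (g (k + 1) - g k)

/-- `x` is a BFGS sequence for `f`: `f` is differentiable with nonzero gradient at every iterate,
and for some parameters `0 < μ < ν < 1` and some positive definite `H₀`, each step lies in the
approximate Newton direction and satisfies the Armijo and the weak Wolfe condition.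
Only the behaviour of `f` near the iterates matters, so for a function on an open set `U`
containing the iterates the values of `f` outside `U` are irrelevant. These conditions force
`sₖᵀ yₖ > 0` for all `k`, so no division by zero occurs in the updates. -/
def IsBFGSSequence {n : ℕ} (f : EuclideanSpace ℝ (Fin n) → ℝ)
    (x : ℕ → EuclideanSpace ℝ (Fin n)) : Prop :=
  (∀ k, DifferentiableAt ℝ f (x k) ∧ gradient f (x k) ≠ 0) ∧
  ∃ (μ ν : ℝ) (H₀ : Matrix (Fin n) (Fin n) ℝ),
    0 < μ ∧ μ < ν ∧ ν < 1 ∧ H₀.PosDef ∧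
    ∀ k,
      (∃ t : ℝ, 0 ≤ t ∧
        bfgsMatrix H₀ x (fun j => gradient f (x j)) k *ᵥ (gradient f (x k)).ofLp
          = -(t • (x (k + 1) - x k).ofLp)) ∧
      f (x (k + 1)) ≤ f (x k) + μ * inner ℝ (gradient f (x k)) (x (k + 1) - x k) ∧
      ν * inner ℝ (gradient f (x k)) (x (k + 1) - x k)
        ≤ inner ℝ (gradient f (x (k + 1))) (x (k + 1) - x k)

/-! The engine is the potential `tr B - log det B` of `B = H⁻¹`, nonnegative on positive definite
matrices. If `‖y‖² ≤ L sᵀy` at every step, each update raises it by at most a constant minus `log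
(‖g‖² / (-gᵀs))` (`trace_sub_log_det_bfgsUpdate_le`). The Armijo condition and boundedness below
force `-gᵀs → 0`, so gradients bounded away from `0` would drive the potential to `-∞`. Hence some
gradients are arbitrarily small (`exists_norm_lt_of_bfgs`).

The curvature bound comes from a `C²` convex function `h` equal to `f` near the compact closure `K`
of the iterates. Segments between iterates may leave the region where `h = f`, but only gradients at
the endpoints matter (`ConvexOn.exists_norm_sq_gradient_sub_le`). By compactness `∇h` vanishes at
some `z ∈ K`; then `z` minimizes `h`, so it is a local, hence global, minimizer of `f`. Since `f (x
k)` decreases and `z` lies in the closure of the iterates, the values converge to `f z`. -/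

/-! ### Matrix algebra of the BFGS update: positivity, inverse, trace and determinant. -/

theorem Matrix.PosDef.det_le_exp_trace {ι : Type*} [Fintype ι] [DecidableEq ι]
    {A : Matrix ι ι ℝ} (hA : A.PosDef) : A.det ≤ Real.exp A.trace := by
  rw [hA.isHermitian.det_eq_prod_eigenvalues, hA.isHermitian.trace_eq_sum_eigenvalues]
  simp only [RCLike.ofReal_real_eq_id, id_eq]
  rw [Real.exp_sum]
  refine Finset.prod_le_prod (fun i _ => (hA.eigenvalues_pos i).le) fun i _ => ?_
  linarith [Real.add_one_le_exp (hA.isHermitian.eigenvalues i)]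

theorem trace_inv_update {ι : Type*} [Fintype ι] (B : Matrix ι ι ℝ) (b y : ι → ℝ) (σ τ : ℝ) :
    (B - σ⁻¹ • vecMulVec b b + τ⁻¹ • vecMulVec y y).trace =
      B.trace - σ⁻¹ * (b ⬝ᵥ b) + τ⁻¹ * (y ⬝ᵥ y) := by
  simp [trace_add, trace_sub, trace_smul, trace_vecMulVec]

section

variable {ι : Type*} [Fintype ι] [DecidableEq ι] {H : Matrix ι ι ℝ} {s y : ι → ℝ}

theorem posDef_bfgs (hH : H.PosDef) (hsy : 0 < s ⬝ᵥ y) :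
    ((1 - (s ⬝ᵥ y)⁻¹ • vecMulVec s y) * H * (1 - (s ⬝ᵥ y)⁻¹ • vecMulVec s y)ᵀ +
      (s ⬝ᵥ y)⁻¹ • vecMulVec s s).PosDef := by
  set τ := s ⬝ᵥ y with hτ
  set V : Matrix ι ι ℝ := 1 - τ⁻¹ • vecMulVec s y with hV
  have h1 : (V * H * Vᵀ).PosSemidef := by
    simpa [conjTranspose_eq_transpose_of_trivial] using
      hH.posSemidef.mul_mul_conjTranspose_same V
  have h2 : (τ⁻¹ • vecMulVec s s).PosSemidef := by
    have := (posSemidef_vecMulVec_self_star s).smul (inv_nonneg.2 hsy.le)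
    simpa using this
  refine posDef_iff_dotProduct_mulVec.2 ⟨(h1.add h2).isHermitian, fun {v} hv => ?_⟩
  have e1 : star v ⬝ᵥ ((V * H * Vᵀ) *ᵥ v) = (Vᵀ *ᵥ v) ⬝ᵥ (H *ᵥ (Vᵀ *ᵥ v)) := by
    rw [star_trivial, ← mulVec_mulVec, ← mulVec_mulVec, dotProduct_mulVec, ← mulVec_transpose]
  have e2 : star v ⬝ᵥ ((τ⁻¹ • vecMulVec s s) *ᵥ v) = τ⁻¹ * (s ⬝ᵥ v) ^ 2 := by
    rw [star_trivial, smul_mulVec, vecMulVec_mulVec, dotProduct_smul, op_smul_eq_smul,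
      dotProduct_smul, smul_eq_mul, smul_eq_mul, dotProduct_comm v s]
    ring
  rw [add_mulVec, dotProduct_add, e1, e2]
  -- If `Vᵀv = 0`, then `v` is a nonzero multiple of `y`, so `sᵀv ≠ 0` and the rank-one term is
  -- positive.
  by_cases hw : Vᵀ *ᵥ v = 0
  · have e3 : Vᵀ *ᵥ v = v - (τ⁻¹ * (s ⬝ᵥ v)) • y := by
      simp [hV, sub_mulVec, smul_mulVec, transpose_vecMulVec, vecMulVec_mulVec, smul_smul]
    have hsv : s ⬝ᵥ v ≠ 0 := by
      intro h0
      rw [hw, h0] at e3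
      simp at e3
      exact hv e3.symm
    rw [hw]
    simp only [zero_dotProduct, zero_add]
    positivity
  · have := hH.dotProduct_mulVec_pos hw
    rw [star_trivial] at this
    positivity

/-- With `b = H⁻¹s`, `σ = sᵀb`, `τ = sᵀy` and `C = H⁻¹ - bbᵀ/σ`, the cancellations are `sᵀC = 0` and
`Vs = 0`: the first summand contributes `VHC = V`, the second `syᵀ/τ = 1 - V`. -/
theorem bfgs_mul_inv_update (hH : H.PosDef) (hsy : 0 < s ⬝ᵥ y) :
    ((1 - (s ⬝ᵥ y)⁻¹ • vecMulVec s y) * H * (1 - (s ⬝ᵥ y)⁻¹ • vecMulVec s y)ᵀ +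
      (s ⬝ᵥ y)⁻¹ • vecMulVec s s) *
      (H⁻¹ - (s ⬝ᵥ (H⁻¹ *ᵥ s))⁻¹ • vecMulVec (H⁻¹ *ᵥ s) (H⁻¹ *ᵥ s) +
        (s ⬝ᵥ y)⁻¹ • vecMulVec y y) = 1 := by
  have hs : s ≠ 0 := by rintro rfl; simp at hsy
  have hσ : 0 < s ⬝ᵥ (H⁻¹ *ᵥ s) := by simpa using hH.inv.dotProduct_mulVec_pos hs
  have hBs : s ᵥ* H⁻¹ = H⁻¹ *ᵥ s := by
    have := hH.inv.isHermitian
    rw [IsHermitian, conjTranspose_eq_transpose_of_trivial] at this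
    rw [← mulVec_transpose, this]
  have hHB : H * H⁻¹ = 1 := mul_nonsing_inv _ ((isUnit_iff_isUnit_det _).1 hH.isUnit)
  have hHb : H *ᵥ (H⁻¹ *ᵥ s) = s := by rw [mulVec_mulVec, hHB, one_mulVec]
  set τ := s ⬝ᵥ y
  set b := H⁻¹ *ᵥ s
  set σ := s ⬝ᵥ b
  set C := H⁻¹ - σ⁻¹ • vecMulVec b b with hC
  have hsC : s ᵥ* C = 0 := by
    rw [hC, vecMul_sub, hBs, vecMul_smul, vecMul_vecMulVec, smul_smul]
    change b - (σ⁻¹ * σ) • b = 0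
    rw [inv_mul_cancel₀ hσ.ne', one_smul, sub_self]
  have hsB : s ᵥ* (C + τ⁻¹ • vecMulVec y y) = y := by
    rw [vecMul_add, hsC, vecMul_smul, vecMul_vecMulVec, smul_smul]
    change 0 + (τ⁻¹ * τ) • y = y
    rw [inv_mul_cancel₀ hsy.ne', one_smul, zero_add]
  have h1 : (1 - τ⁻¹ • vecMulVec s y)ᵀ * (C + τ⁻¹ • vecMulVec y y) = C := by
    rw [transpose_sub, transpose_smul, transpose_vecMulVec, transpose_one, sub_mul, one_mul,
      smul_mul, vecMulVec_mul, hsB, add_sub_cancel_right]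
  have hys : y ⬝ᵥ s = τ := dotProduct_comm _ _
  have h2 : H * C = 1 - σ⁻¹ • vecMulVec s b := by
    rw [hC, mul_sub, hHB, Matrix.mul_smul, mul_vecMulVec, hHb]
  have h3 : (1 - τ⁻¹ • vecMulVec s y) * (1 - σ⁻¹ • vecMulVec s b) =
      1 - τ⁻¹ • vecMulVec s y := by
    rw [mul_sub, mul_one, Matrix.mul_smul, mul_vecMulVec, sub_mulVec, one_mulVec, smul_mulVec,
      vecMulVec_mulVec, hys]
    have : s - τ⁻¹ • MulOpposite.op τ • s = 0 := by
      ext i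
      simp [← mul_assoc, inv_mul_cancel₀ hsy.ne']
    rw [this]
    simp
  rw [add_mul, mul_assoc, h1, mul_assoc, h2, h3, smul_mul, vecMulVec_mul, hsB, sub_add_cancel]

theorem inv_bfgs (hH : H.PosDef) (hsy : 0 < s ⬝ᵥ y) :
    ((1 - (s ⬝ᵥ y)⁻¹ • vecMulVec s y) * H * (1 - (s ⬝ᵥ y)⁻¹ • vecMulVec s y)ᵀ +
      (s ⬝ᵥ y)⁻¹ • vecMulVec s s)⁻¹ =
      H⁻¹ - (s ⬝ᵥ (H⁻¹ *ᵥ s))⁻¹ • vecMulVec (H⁻¹ *ᵥ s) (H⁻¹ *ᵥ s) +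
        (s ⬝ᵥ y)⁻¹ • vecMulVec y y :=
  inv_eq_right_inv (bfgs_mul_inv_update hH hsy)

/-- The new inverse is `H⁻¹ (1 + PQ)` with `PQ` of rank at most two, and `det (1 + PQ) = det (1 +
QP)` is a `2 × 2` determinant. The upper left entry of `1 + QP` is `0`, so `yᵀHy` drops out. -/
theorem det_inv_update (hH : H.PosDef) (hsy : 0 < s ⬝ᵥ y) :
    (H⁻¹ - (s ⬝ᵥ (H⁻¹ *ᵥ s))⁻¹ • vecMulVec (H⁻¹ *ᵥ s) (H⁻¹ *ᵥ s) +
        (s ⬝ᵥ y)⁻¹ • vecMulVec y y).det =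
      H⁻¹.det * ((s ⬝ᵥ y) / (s ⬝ᵥ (H⁻¹ *ᵥ s))) := by
  have hs : s ≠ 0 := by rintro rfl; simp at hsy
  have hσ : 0 < s ⬝ᵥ (H⁻¹ *ᵥ s) := by simpa using hH.inv.dotProduct_mulVec_pos hs
  have hHB : H⁻¹ * H = 1 := nonsing_inv_mul _ ((isUnit_iff_isUnit_det _).1 hH.isUnit)
  have hsym : (H⁻¹)ᵀ = H⁻¹ := by
    have := hH.inv.isHermitian
    rwa [IsHermitian, conjTranspose_eq_transpose_of_trivial] at this
  have hby : (H⁻¹ *ᵥ s) ⬝ᵥ (H *ᵥ y) = s ⬝ᵥ y := by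
    rw [← vecMul_transpose, hsym, ← dotProduct_mulVec, mulVec_mulVec, hHB, one_mulVec]
  have hBHy : H⁻¹ *ᵥ (H *ᵥ y) = y := by rw [mulVec_mulVec, hHB, one_mulVec]
  set τ := s ⬝ᵥ y
  set b := H⁻¹ *ᵥ s with hb
  set σ := s ⬝ᵥ b with hσ'
  let P : Matrix ι (Fin 2) ℝ := (Matrix.of ![-(σ⁻¹ • s), τ⁻¹ • (H *ᵥ y)])ᵀ
  let Q : Matrix (Fin 2) ι ℝ := Matrix.of ![b, y]
  have hPQ : P * Q = -(σ⁻¹ • vecMulVec s b) + τ⁻¹ • vecMulVec (H *ᵥ y) y := by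
    ext i j
    simp [P, Q, mul_apply, Fin.sum_univ_two, vecMulVec_apply, mul_assoc]
  have hfac : H⁻¹ - σ⁻¹ • vecMulVec b b + τ⁻¹ • vecMulVec y y = H⁻¹ * (1 + P * Q) := by
    rw [hPQ, mul_add, mul_add, mul_one, mul_neg, Matrix.mul_smul, Matrix.mul_smul, mul_vecMulVec,
      mul_vecMulVec, hBHy, ← hb]
    abel
  have hQP : Q * P = !![-1, 1; -(σ⁻¹ * τ), τ⁻¹ * (y ⬝ᵥ (H *ᵥ y))] := by
    have e00 : (Q * P) 0 0 = b ⬝ᵥ (-(σ⁻¹ • s)) := rfl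
    have e01 : (Q * P) 0 1 = b ⬝ᵥ (τ⁻¹ • H *ᵥ y) := rfl
    have e10 : (Q * P) 1 0 = y ⬝ᵥ (-(σ⁻¹ • s)) := rfl
    have e11 : (Q * P) 1 1 = y ⬝ᵥ (τ⁻¹ • H *ᵥ y) := rfl
    rw [eta_fin_two (Q * P), e00, e01, e10, e11]
    simp only [dotProduct_neg, dotProduct_smul, smul_eq_mul, dotProduct_comm b s, ← hσ', hby,
      dotProduct_comm y s, inv_mul_cancel₀ hσ.ne', inv_mul_cancel₀ hsy.ne', τ]
  rw [hfac, det_mul, det_one_add_mul_comm, hQP, det_fin_two]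
  congr 1
  simp
  field_simp

end

/-! ### Gradient inequalities for convex functions. -/

section

variable {E : Type*} [NormedAddCommGroup E] [NormedSpace ℝ E]

theorem ConvexOn.fderiv_sub_le {U : Set E} {f : E → ℝ} (hf : ConvexOn ℝ U f) {p q : E}
    (hp : p ∈ U) (hq : q ∈ U) (hd : DifferentiableAt ℝ f p) :
    fderiv ℝ f p (q - p) ≤ f q - f p := by
  have hderiv : HasDerivAt (fun t : ℝ => f (p + t • (q - p))) (fderiv ℝ f p (q - p)) 0 := by
    have h1 : HasDerivAt (fun t : ℝ => p + t • (q - p)) (q - p) 0 := by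
      simpa using ((hasDerivAt_id (0 : ℝ)).smul_const (q - p)).const_add p
    have h2 : HasFDerivAt f (fderiv ℝ f p) (p + (0 : ℝ) • (q - p)) := by
      simpa using hd.hasFDerivAt
    exact h2.comp_hasDerivAt 0 h1
  have h0 := hderiv.hasDerivWithinAt (s := Set.Ioi 0)
  rw [hasDerivWithinAt_iff_tendsto_slope' (by simp)] at h0
  refine le_of_tendsto h0 ?_
  filter_upwards [Ioc_mem_nhdsGT (zero_lt_one (α := ℝ))] with t ht
  have hc := hf.2 hp hq (sub_nonneg.2 ht.2) ht.1.le (by ring)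
  have e : (1 - t) • p + t • q = p + t • (q - p) := by module
  rw [e] at hc
  simp only [smul_eq_mul] at hc
  rw [slope_def_field, div_le_iff₀ (by simpa using ht.1)]
  simp
  linarith

theorem ConvexOn.fderiv_fderiv_nonneg {U : Set E} (hU : IsOpen U) {f : E → ℝ}
    (hf : ConvexOn ℝ U f) (hC : ContDiffOn ℝ 2 f U) {p : E} (hp : p ∈ U) (v : E) :
    0 ≤ fderiv ℝ (fderiv ℝ f) p v v := by
  have hd : ∀ q ∈ U, DifferentiableAt ℝ f q := fun q hq =>
    (hC.differentiableOn (by norm_num)).differentiableAt (hU.mem_nhds hq)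
  have hd2 : DifferentiableAt ℝ (fderiv ℝ f) p :=
    ((hC.fderiv_of_isOpen hU (m := 1) (by norm_num)).differentiableOn
      (by norm_num)).differentiableAt (hU.mem_nhds hp)
  have hline : HasDerivAt (fun t : ℝ => p + t • v) v 0 := by
    simpa using ((hasDerivAt_id (0 : ℝ)).smul_const v).const_add p
  have hderiv : HasDerivAt (fun t : ℝ => fderiv ℝ f (p + t • v) v)
      (fderiv ℝ (fderiv ℝ f) p v v) 0 := by
    have h2 : HasFDerivAt (fderiv ℝ f) (fderiv ℝ (fderiv ℝ f) p) (p + (0 : ℝ) • v) := by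
      simpa using hd2.hasFDerivAt
    have h3 := h2.comp_hasDerivAt 0 hline
    simpa using h3.clm_apply (hasDerivAt_const 0 v)
  have h0 := hderiv.hasDerivWithinAt (s := Set.Ioi 0)
  rw [hasDerivWithinAt_iff_tendsto_slope' (by simp)] at h0
  refine ge_of_tendsto h0 ?_
  have hmem : ∀ᶠ t : ℝ in nhds 0, p + t • v ∈ U :=
    hline.continuousAt.eventually_mem (by simpa using hU.mem_nhds hp)
  filter_upwards [hmem.filter_mono nhdsWithin_le_nhds, self_mem_nhdsWithin] with t ht ht0
  rw [Set.mem_Ioi] at ht0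
  -- The two tangent inequalities add up to monotonicity of the derivative along the line.
  have h1 := hf.fderiv_sub_le hp ht (hd p hp)
  have h2 := hf.fderiv_sub_le ht hp (hd _ ht)
  simp only [add_sub_cancel_left, sub_add_cancel_left, map_neg, map_smul, smul_eq_mul] at h1 h2
  rw [slope_def_field]
  simp only [zero_smul, add_zero, sub_zero]
  refine div_nonneg ?_ ht0.le
  nlinarith

/-- For a positive semidefinite Hessian `A` of norm at most `L`, expanding `0 ≤ A(w - Lu, w - Lu)`
gives `A(u, w) ≤ (‖w‖² + L A(u, u)) / 2`. Integrating along the segment from `p` to `q`, with `u = q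
- p`, gives the claim. Choosing `w` as the gradient difference later yields `‖y‖² ≤ L sᵀy`. -/
theorem ConvexOn.exists_fderiv_sub_le {U : Set E} (hU : IsOpen U) {f : E → ℝ}
    (hf : ConvexOn ℝ U f) (hC : ContDiffOn ℝ 2 f U) {K : Set E} (hK : IsCompact K)
    (hKU : K ⊆ U) :
    ∃ L : ℝ, 0 < L ∧ ∀ p ∈ K, ∀ q ∈ K, ∀ w : E, (fderiv ℝ f q - fderiv ℝ f p) w ≤
      (‖w‖ ^ 2 + L * (fderiv ℝ f q - fderiv ℝ f p) (q - p)) / 2 := by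
  have hC1 : ContDiffOn ℝ 1 (fderiv ℝ f) U := hC.fderiv_of_isOpen hU (by norm_num)
  have hC0 : ContinuousOn (fderiv ℝ (fderiv ℝ f)) U :=
    hC1.continuousOn_fderiv_of_isOpen hU le_rfl
  -- The union of all segments between points of `K`, a compact set on which the Hessian is bounded.
  let S : Set E := (fun a : (E × E) × ℝ => a.1.1 + a.2 • (a.1.2 - a.1.1)) ''
    ((K ×ˢ K) ×ˢ Set.Icc (0 : ℝ) 1)
  have hS : IsCompact S := ((hK.prod hK).prod isCompact_Icc).image (by fun_prop)
  have hSU : S ⊆ U := by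
    rintro _ ⟨⟨⟨p, q⟩, t⟩, ⟨⟨hp, hq⟩, ht⟩, rfl⟩
    exact hf.1.add_smul_sub_mem (hKU hp) (hKU hq) ht
  have hCn : ContinuousOn (fun z => ‖fderiv ℝ (fderiv ℝ f) z‖) U :=
    (continuous_norm (E := E →L[ℝ] E →L[ℝ] ℝ)).comp_continuousOn hC0
  obtain ⟨M, hM⟩ := hS.bddAbove_image (hCn.mono hSU)
  -- The maximum with `1` makes the constant positive, so that it can be divided out.
  refine ⟨max M 1, by positivity, fun p hp q hq w => ?_⟩
  set L := max M 1 with hL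
  have hL0 : 0 < L := by positivity
  set u := q - p with hu
  let γ : ℝ → E := fun t => p + t • u
  have hγS : ∀ t ∈ Set.Icc (0 : ℝ) 1, γ t ∈ S := fun t ht => ⟨⟨⟨p, q⟩, t⟩, ⟨⟨hp, hq⟩, ht⟩, rfl⟩
  have hγ : ∀ t, HasDerivAt γ u t := fun t => by
    have h := ((hasDerivAt_id t).smul_const u).const_add p
    rwa [one_smul] at h
  have hG : ∀ t ∈ Set.Icc (0 : ℝ) 1, HasDerivAt (fun t => fderiv ℝ f (γ t))
      (fderiv ℝ (fderiv ℝ f) (γ t) u) t := fun t ht =>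
    ((hC1.differentiableOn one_ne_zero).differentiableAt
      (hU.mem_nhds (hSU (hγS t ht)))).hasFDerivAt.comp_hasDerivAt t (hγ t)
  let φ : ℝ → ℝ := fun t => t * ‖w‖ ^ 2 / 2 + L * fderiv ℝ f (γ t) u / 2 - fderiv ℝ f (γ t) w
  have hφ : ∀ t ∈ Set.Icc (0 : ℝ) 1, HasDerivAt φ (‖w‖ ^ 2 / 2 +
      L * fderiv ℝ (fderiv ℝ f) (γ t) u u / 2 - fderiv ℝ (fderiv ℝ f) (γ t) u w) t := by
    intro t ht
    have h := hG t ht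
    have h' (v : E) : HasDerivAt (fun t => fderiv ℝ f (γ t) v)
        (fderiv ℝ (fderiv ℝ f) (γ t) u v) t := by
      simpa using h.clm_apply (hasDerivAt_const t v)
    have h1 := ((h' u).const_mul L).div_const 2
    have h2 := h' w
    have h3 : HasDerivAt (fun t : ℝ => t * ‖w‖ ^ 2 / 2) (‖w‖ ^ 2 / 2) t := by
      simpa using ((hasDerivAt_id t).mul_const (‖w‖ ^ 2)).div_const 2
    exact (h3.add h1).sub h2
  have hmono : MonotoneOn φ (Set.Icc 0 1) := by
    refine monotoneOn_of_hasDerivWithinAt_nonneg (convex_Icc 0 1)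
      (fun t ht => (hφ t ht).continuousAt.continuousWithinAt)
      (fun t ht => (hφ t (interior_subset ht)).hasDerivWithinAt) fun t ht => ?_
    have ht' := interior_subset ht
    have hγU := hSU (hγS t ht')
    set A := fderiv ℝ (fderiv ℝ f) (γ t)
    have hsymm : A u w = A w u :=
      ((hC.contDiffAt (hU.mem_nhds hγU)).isSymmSndFDerivAt (by simp)).eq u w
    have hpos : 0 ≤ A (w - L • u) (w - L • u) := hf.fderiv_fderiv_nonneg hU hC hγU _
    have hbd : A w w ≤ L * ‖w‖ ^ 2 := by
      have h1 := (A w).le_opNorm w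
      have h2 := A.le_opNorm w
      have h3 : ‖A‖ ≤ L := (hM ⟨_, hγS t ht', rfl⟩).trans (le_max_left _ _)
      have h4 := le_abs_self (A w w)
      rw [Real.norm_eq_abs] at h1
      have h5 : ‖A‖ * ‖w‖ * ‖w‖ ≤ L * ‖w‖ * ‖w‖ := by gcongr
      have h6 : ‖A w‖ * ‖w‖ ≤ ‖A‖ * ‖w‖ * ‖w‖ := by gcongr
      nlinarith
    simp only [map_sub, map_smul, _root_.sub_apply, _root_.smul_apply,
      smul_eq_mul, ← hsymm] at hpos
    have h7 : 0 ≤ L * (‖w‖ ^ 2 / 2 + L * A u u / 2 - A u w) := by nlinarith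
    exact nonneg_of_mul_nonneg_right h7 hL0
  have h01 := hmono (Set.left_mem_Icc.2 zero_le_one) (Set.right_mem_Icc.2 zero_le_one) zero_le_one
  have e0 : γ 0 = p := by simp [γ]
  have e1 : γ 1 = q := by simp [γ, hu]
  simp only [φ, e0, e1] at h01
  simp only [_root_.sub_apply]
  linarith

end

theorem ConvexOn.exists_norm_sq_gradient_sub_le {E : Type*} [NormedAddCommGroup E]
    [InnerProductSpace ℝ E] [CompleteSpace E] {U : Set E} (hU : IsOpen U) {f : E → ℝ}
    (hf : ConvexOn ℝ U f) (hC : ContDiffOn ℝ 2 f U) {K : Set E} (hK : IsCompact K)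
    (hKU : K ⊆ U) :
    ∃ L : ℝ, 0 < L ∧ ∀ p ∈ K, ∀ q ∈ K,
      ‖gradient f q - gradient f p‖ ^ 2 ≤ L * inner ℝ (q - p) (gradient f q - gradient f p) := by
  obtain ⟨L, hL, h⟩ := hf.exists_fderiv_sub_le hU hC hK hKU
  refine ⟨L, hL, fun p hp q hq => ?_⟩
  have key : ∀ w, (fderiv ℝ f q - fderiv ℝ f p) w = inner ℝ (gradient f q - gradient f p) w := by
    intro w
    rw [inner_sub_left, inner_gradient_left, inner_gradient_left]
    rfl
  have h1 := h p hp q hq (gradient f q - gradient f p)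
  rw [key, key, real_inner_self_eq_norm_sq] at h1
  rw [real_inner_comm]
  linarith

/-! ### The potential `tr B - log det B` along one BFGS step. -/

section

variable {n : ℕ} {H : Matrix (Fin n) (Fin n) ℝ} {s y g : EuclideanSpace ℝ (Fin n)}

theorem EuclideanSpace.real_inner_eq_dotProduct (s y : EuclideanSpace ℝ (Fin n)) :
    inner ℝ s y = s.ofLp ⬝ᵥ y.ofLp := by
  rw [EuclideanSpace.inner_eq_star_dotProduct, star_trivial, dotProduct_comm]

theorem bfgsUpdate_posDef (hH : H.PosDef) (hsy : 0 < inner ℝ s y) :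
    (bfgsUpdate H s y).PosDef := by
  rw [EuclideanSpace.real_inner_eq_dotProduct] at hsy
  rw [bfgsUpdate, EuclideanSpace.real_inner_eq_dotProduct]
  exact posDef_bfgs hH hsy

theorem inner_pos_of_mulVec_eq {t : ℝ} (hH : H.PosDef) (hg : g ≠ 0) (ht : 0 ≤ t)
    (hs : H *ᵥ g.ofLp = -(t • s.ofLp)) : 0 < t ∧ 0 < -inner ℝ g s := by
  have hg' : g.ofLp ≠ 0 := by simpa using hg
  have h := hH.dotProduct_mulVec_pos hg'
  rw [star_trivial, hs, dotProduct_neg, dotProduct_smul, smul_eq_mul,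
    ← EuclideanSpace.real_inner_eq_dotProduct] at h
  have ht0 : 0 < t := ht.lt_of_ne (by rintro rfl; simp at h)
  exact ⟨ht0, by nlinarith [mul_pos ht0 ht0]⟩

theorem inv_mulVec_of_mulVec_eq {t : ℝ} (hH : H.PosDef) (ht : 0 < t)
    (hs : H *ᵥ g.ofLp = -(t • s.ofLp)) : H⁻¹ *ᵥ s.ofLp = -(t⁻¹ • g.ofLp) := by
  have hHB : H⁻¹ * H = 1 := nonsing_inv_mul _ ((isUnit_iff_isUnit_det _).1 hH.isUnit)
  have h : g.ofLp = -(t • (H⁻¹ *ᵥ s.ofLp)) := by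
    rw [← mulVec_smul, ← mulVec_neg, ← hs, mulVec_mulVec, hHB, one_mulVec]
  rw [h, smul_neg, neg_neg, smul_smul, inv_mul_cancel₀ ht.ne', one_smul]

/-- Since `H⁻¹s = -g/t`, with `a = -gᵀs` the trace changes by `-‖g‖²/(at) + ‖y‖²/sᵀy` and the
determinant is multiplied by `t sᵀy / a ≥ ct`. The unknown scale `t` is eliminated by `log u ≤ u -
1` at `u = ‖g‖²/(at)`. -/
theorem trace_sub_log_det_bfgsUpdate_le {t c L : ℝ} (hH : H.PosDef) (hg : g ≠ 0) (ht : 0 ≤ t)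
    (hs : H *ᵥ g.ofLp = -(t • s.ofLp)) (hc : 0 < c) (hsy : c * -inner ℝ g s ≤ inner ℝ s y)
    (hy : ‖y‖ ^ 2 ≤ L * inner ℝ s y) :
    (bfgsUpdate H s y)⁻¹.trace - Real.log (bfgsUpdate H s y)⁻¹.det ≤
      H⁻¹.trace - Real.log H⁻¹.det + (L - 1 - Real.log c) -
        Real.log (‖g‖ ^ 2 / -inner ℝ g s) := by
  obtain ⟨ht, ha⟩ := inner_pos_of_mulVec_eq hH hg ht hs
  set a := -inner ℝ g s with ha'
  have hB := inv_mulVec_of_mulVec_eq hH ht hs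
  have hsy0 : 0 < inner ℝ s y := (mul_pos hc ha).trans_le hsy
  have hgn : 0 < ‖g‖ := norm_pos_iff.2 hg
  have hσ : s.ofLp ⬝ᵥ (H⁻¹ *ᵥ s.ofLp) = a / t := by
    rw [hB, dotProduct_neg, dotProduct_smul, ← EuclideanSpace.real_inner_eq_dotProduct,
      real_inner_comm, ha', smul_eq_mul]
    ring
  have hbb : (H⁻¹ *ᵥ s.ofLp) ⬝ᵥ (H⁻¹ *ᵥ s.ofLp) = ‖g‖ ^ 2 / t ^ 2 := by
    rw [hB, dotProduct_neg, neg_dotProduct, neg_neg, dotProduct_smul, smul_dotProduct,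
      ← EuclideanSpace.real_inner_eq_dotProduct, real_inner_self_eq_norm_sq, smul_eq_mul,
      smul_eq_mul]
    field_simp
  have hdot : s.ofLp ⬝ᵥ y.ofLp = inner ℝ s y :=
    (EuclideanSpace.real_inner_eq_dotProduct s y).symm
  have hinv := inv_bfgs hH (hdot ▸ hsy0)
  rw [hdot, ← bfgsUpdate] at hinv
  have hdet : (bfgsUpdate H s y)⁻¹.det = H⁻¹.det * (inner ℝ s y * t / a) := by
    rw [hinv, ← hdot, det_inv_update hH (hdot ▸ hsy0), hσ]
    field_simp
  have htr : (bfgsUpdate H s y)⁻¹.trace = H⁻¹.trace - ‖g‖ ^ 2 / (a * t) +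
      ‖y‖ ^ 2 / inner ℝ s y := by
    rw [hinv, trace_inv_update, hbb, hσ, ← EuclideanSpace.real_inner_eq_dotProduct,
      real_inner_self_eq_norm_sq]
    field_simp
  have hD : 0 < H⁻¹.det := hH.inv.det_pos
  have h1 : ‖y‖ ^ 2 / inner ℝ s y ≤ L := (div_le_iff₀ hsy0).2 hy
  have h2 : Real.log c + Real.log t ≤ Real.log (inner ℝ s y * t / a) := by
    rw [← Real.log_mul hc.ne' ht.ne']
    refine Real.log_le_log (by positivity) ?_
    rw [le_div_iff₀ ha]
    nlinarith
  have h3 : Real.log (‖g‖ ^ 2 / a) - Real.log t + 1 ≤ ‖g‖ ^ 2 / (a * t) := by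
    rw [← Real.log_div (by positivity) ht.ne', div_div]
    have := Real.log_le_sub_one_of_pos (x := ‖g‖ ^ 2 / (a * t)) (by positivity)
    linarith
  rw [hdet, htr, Real.log_mul hD.ne' (by positivity)]
  linarith

end

/-! ### Arbitrarily small gradients along a BFGS sequence. -/

theorem not_tendsto_atTop_of_le_add_sub {ψ r : ℕ → ℝ} {C : ℝ} (hψ : ∀ k, 0 ≤ ψ k)
    (h : ∀ k, ψ (k + 1) ≤ ψ k + C - r k) : ¬ Filter.Tendsto r Filter.atTop Filter.atTop := by
  intro hr
  -- Beyond `N`, the sequence `ψ` drops by at least `1` at each step.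
  obtain ⟨N, hN⟩ := Filter.eventually_atTop.1 (hr.eventually_ge_atTop (C + 1))
  have hdec : ∀ j : ℕ, ψ (N + j) ≤ ψ N - j := by
    intro j
    induction j with
    | zero => simp
    | succ j ih =>
      have h1 := h (N + j)
      have h2 := hN (N + j) (Nat.le_add_right _ _)
      rw [← add_assoc]
      push_cast
      linarith
  obtain ⟨j, hj⟩ := exists_nat_gt (ψ N)
  linarith [hdec j, hψ (N + j)]

theorem le_inner_sub_of_wolfe {F : Type*} [NormedAddCommGroup F] [InnerProductSpace ℝ F]
    {ν : ℝ} {s g g' : F} (h : ν * inner ℝ g s ≤ inner ℝ g' s) :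
    (1 - ν) * -inner ℝ g s ≤ inner ℝ s (g' - g) := by
  rw [real_inner_comm (g' - g), inner_sub_left]
  linarith

theorem bfgsMatrix_posDef {n : ℕ} {x g : ℕ → EuclideanSpace ℝ (Fin n)}
    {H₀ : Matrix (Fin n) (Fin n) ℝ} (hH₀ : H₀.PosDef) {ν : ℝ} (hν : ν < 1)
    (hg : ∀ k, g k ≠ 0)
    (hstep : ∀ k, ∃ t : ℝ, 0 ≤ t ∧
      bfgsMatrix H₀ x g k *ᵥ (g k).ofLp = -(t • (x (k + 1) - x k).ofLp))
    (hwolfe : ∀ k, ν * inner ℝ (g k) (x (k + 1) - x k) ≤ inner ℝ (g (k + 1)) (x (k + 1) - x k))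
    (k : ℕ) : (bfgsMatrix H₀ x g k).PosDef := by
  induction k with
  | zero => exact hH₀
  | succ k ih =>
    obtain ⟨t, ht, hs⟩ := hstep k
    obtain ⟨-, ha⟩ := inner_pos_of_mulVec_eq ih (hg k) ht hs
    exact bfgsUpdate_posDef ih
      ((mul_pos (sub_pos.2 hν) ha).trans_le (le_inner_sub_of_wolfe (hwolfe k)))

theorem neg_inner_pos_of_bfgs {n : ℕ} {x g : ℕ → EuclideanSpace ℝ (Fin n)}
    {H₀ : Matrix (Fin n) (Fin n) ℝ} (hH₀ : H₀.PosDef) {ν : ℝ} (hν : ν < 1)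
    (hg : ∀ k, g k ≠ 0)
    (hstep : ∀ k, ∃ t : ℝ, 0 ≤ t ∧
      bfgsMatrix H₀ x g k *ᵥ (g k).ofLp = -(t • (x (k + 1) - x k).ofLp))
    (hwolfe : ∀ k, ν * inner ℝ (g k) (x (k + 1) - x k) ≤ inner ℝ (g (k + 1)) (x (k + 1) - x k))
    (k : ℕ) : 0 < -inner ℝ (g k) (x (k + 1) - x k) := by
  obtain ⟨t, ht, hs⟩ := hstep k
  exact (inner_pos_of_mulVec_eq (bfgsMatrix_posDef hH₀ hν hg hstep hwolfe k) (hg k) ht hs).2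

theorem exists_norm_lt_of_bfgs {n : ℕ} {x g : ℕ → EuclideanSpace ℝ (Fin n)}
    {H₀ : Matrix (Fin n) (Fin n) ℝ} (hH₀ : H₀.PosDef) {ν L : ℝ} (hν : ν < 1)
    (hg : ∀ k, g k ≠ 0)
    (hstep : ∀ k, ∃ t : ℝ, 0 ≤ t ∧
      bfgsMatrix H₀ x g k *ᵥ (g k).ofLp = -(t • (x (k + 1) - x k).ofLp))
    (hwolfe : ∀ k, ν * inner ℝ (g k) (x (k + 1) - x k) ≤ inner ℝ (g (k + 1)) (x (k + 1) - x k))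
    (hL : ∀ k, ‖g (k + 1) - g k‖ ^ 2 ≤ L * inner ℝ (x (k + 1) - x k) (g (k + 1) - g k))
    (hlim : Filter.Tendsto (fun k => -inner ℝ (g k) (x (k + 1) - x k)) Filter.atTop (nhds 0))
    {ε : ℝ} (hε : 0 < ε) : ∃ k, ‖g k‖ < ε := by
  have hH := bfgsMatrix_posDef hH₀ hν hg hstep hwolfe
  have ha := neg_inner_pos_of_bfgs hH₀ hν hg hstep hwolfe
  by_contra! hlow
  refine not_tendsto_atTop_of_le_add_sub
    (ψ := fun k => (bfgsMatrix H₀ x g k)⁻¹.trace - Real.log (bfgsMatrix H₀ x g k)⁻¹.det)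
    (r := fun k => Real.log (‖g k‖ ^ 2 / -inner ℝ (g k) (x (k + 1) - x k)))
    (C := L - 1 - Real.log (1 - ν)) (fun k => ?_) (fun k => ?_) ?_
  · have h1 := (hH k).inv.det_le_exp_trace
    have h2 := (Real.log_le_iff_le_exp (hH k).inv.det_pos).2 h1
    exact sub_nonneg.2 h2
  · obtain ⟨t, ht, hs⟩ := hstep k
    exact trace_sub_log_det_bfgsUpdate_le (hH k) (hg k) ht hs (sub_pos.2 hν)
      (le_inner_sub_of_wolfe (hwolfe k)) (hL k)
  · have hinv : Filter.Tendsto (fun k => (-inner ℝ (g k) (x (k + 1) - x k))⁻¹) Filter.atTop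
        Filter.atTop :=
      tendsto_inv_nhdsGT_zero.comp (tendsto_nhdsWithin_iff.2 ⟨hlim, Filter.Eventually.of_forall ha⟩)
    have hmul := hinv.const_mul_atTop (r := ε ^ 2) (by positivity)
    refine Real.tendsto_log_atTop.comp (Filter.tendsto_atTop_mono (fun k => ?_) hmul)
    rw [← div_eq_mul_inv]
    have := hlow k
    have := ha k
    gcongr

/-! ### Compactness and the passage to the limit. -/

theorem Metric.exists_lt_infEDist_of_isCompact {E : Type*} [PseudoEMetricSpace E] {K V : Set E}
    (hK : IsCompact K) (hV : IsOpen V) (hKV : K ⊆ V) :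
    ∃ δ : ℝ, 0 < δ ∧ ∀ z ∈ K, ENNReal.ofReal δ < Metric.infEDist z Vᶜ := by
  obtain ⟨r, hr, h⟩ := Metric.exists_pos_forall_lt_edist hK hV.isClosed_compl
    (Set.disjoint_compl_right_iff_subset.2 hKV)
  -- The infimum may equal `r`; halving restores strictness.
  refine ⟨r / 2, by positivity, fun z hz => ?_⟩
  have h1 : (r : ENNReal) ≤ Metric.infEDist z Vᶜ :=
    Metric.le_infEDist.2 fun w hw => (h z hz w hw).le
  refine lt_of_lt_of_le ?_ h1
  rw [← ENNReal.ofReal_coe_nnreal]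
  exact (ENNReal.ofReal_lt_ofReal_iff (by positivity)).2 (half_lt_self (by positivity))

theorem exists_eq_zero_of_forall_exists_norm_lt {E F : Type*} [TopologicalSpace E]
    [NormedAddCommGroup F] {K : Set E} (hK : IsCompact K) (hne : K.Nonempty) {G : E → F}
    (hG : ContinuousOn G K) (h : ∀ ε > 0, ∃ z ∈ K, ‖G z‖ < ε) : ∃ z ∈ K, G z = 0 := by
  obtain ⟨z, hz, hmin⟩ := hK.exists_isMinOn hne hG.norm
  refine ⟨z, hz, by_contra fun h0 => ?_⟩
  obtain ⟨w, hw, hlt⟩ := h ‖G z‖ (norm_pos_iff.2 h0)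
  exact absurd (isMinOn_iff.1 hmin w hw) (not_le.2 hlt)

theorem tendsto_of_antitone_of_mem_closure {E : Type*} [TopologicalSpace E] {f : E → ℝ}
    {x : ℕ → E} {z : E} (hanti : Antitone fun k => f (x k)) (hz : z ∈ closure (Set.range x))
    (hc : ContinuousAt f z) (hle : ∀ k, f z ≤ f (x k)) :
    Filter.Tendsto (fun k => f (x k)) Filter.atTop (nhds (f z)) := by
  refine tendsto_atTop_isGLB hanti ⟨?_, fun b hb => ?_⟩
  · rintro _ ⟨k, rfl⟩
    exact hle k
  · by_contra! hlt
    obtain ⟨_, hw, k, rfl⟩ := mem_closure_iff_nhds.1 hz _ (hc.eventually_lt_const hlt)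
    exact absurd (hb ⟨k, rfl⟩) (not_le.2 hw)

theorem theorem4 {n : ℕ} (U : Set (EuclideanSpace ℝ (Fin n))) (hU : IsOpen U)
    (f : EuclideanSpace ℝ (Fin n) → ℝ) (hf : ConvexOn ℝ U f)
    (x : ℕ → EuclideanSpace ℝ (Fin n)) (hxU : ∀ k, x k ∈ U) (hx : IsBFGSSequence f x)
    (hbdd : Bornology.IsBounded {z | z ∈ U ∧ f z ≤ f (x 0)})
    (V : Set (EuclideanSpace ℝ (Fin n))) (hV : IsOpen V) (hVU : V ⊆ U)
    (hxV : closure (Set.range x) ⊆ V)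
    (m : ℝ) (hm : IsGLB (f '' U) m) (hmV : IsGLB (f '' V) m)
    (happrox : ∀ δ : ℝ, 0 < δ →
      ∃ (Uδ : Set (EuclideanSpace ℝ (Fin n))) (fδ : EuclideanSpace ℝ (Fin n) → ℝ),
        IsOpen Uδ ∧ Convex ℝ Uδ ∧ Uδ ⊆ U ∧ {z | z ∈ U ∧ f z ≤ f (x 0)} ⊆ Uδ ∧
        ContDiffOn ℝ 2 fδ Uδ ∧ ConvexOn ℝ Uδ fδ ∧
        ∀ z ∈ Uδ, ENNReal.ofReal δ < Metric.infEDist z Vᶜ → fδ z = f z) :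
    IsLeast (f '' U) m ∧
      Filter.Tendsto (fun k => f (x k)) Filter.atTop (nhds m) := by
  obtain ⟨hdiff, μ, ν, H₀, hμ, hμν, hν, hH₀, hstep⟩ := hx
  have hdesc : ∀ k, 0 < -inner ℝ (gradient f (x k)) (x (k + 1) - x k) :=
    neg_inner_pos_of_bfgs hH₀ hν (fun k => (hdiff k).2) (fun k => (hstep k).1)
      (fun k => (hstep k).2.2)
  have hanti : Antitone fun k => f (x k) := antitone_nat_of_succ_le fun k => by
    nlinarith [(hstep k).2.1, hdesc k]
  have hfc : ContinuousOn f U := hf.continuousOn hU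
  set K := closure (Set.range x) with hKdef
  have hxK : ∀ k, x k ∈ K := fun k => subset_closure ⟨k, rfl⟩
  have hKU : K ⊆ U := hxV.trans hVU
  have hKlev : K ⊆ {z | z ∈ U ∧ f z ≤ f (x 0)} := by
    refine fun z hz => ⟨hKU hz, ?_⟩
    by_contra! hlt
    obtain ⟨_, hw, k, rfl⟩ := mem_closure_iff_nhds.1 hz _
      ((hfc.continuousAt (hU.mem_nhds (hKU hz))).eventually_const_lt hlt)
    exact absurd (hanti (Nat.zero_le k)) (not_le.2 hw)
  have hK : IsCompact K := Metric.isCompact_of_isClosed_isBounded isClosed_closure (hbdd.subset hKlev)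
  obtain ⟨δ, hδ, hδK⟩ := Metric.exists_lt_infEDist_of_isCompact hK hV hxV
  obtain ⟨W, h, hW, -, hWU, hlevW, hC, hh, heq⟩ := happrox δ hδ
  have hKW : K ⊆ W := hKlev.trans hlevW
  -- Agreement on neighbourhoods, not just on `K`, transfers gradients and local minimality.
  have hev : ∀ z ∈ K, h =ᶠ[nhds z] f := by
    intro z hz
    filter_upwards [hW.mem_nhds (hKW hz),
      Metric.continuous_infEDist.continuousAt.eventually_const_lt (hδK z hz)] with w hw hw'
    exact heq w hw hw'
  have hgrad : ∀ k, gradient h (x k) = gradient f (x k) := fun k => (hev _ (hxK k)).gradient_eq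
  obtain ⟨L, -, hL⟩ := hh.exists_norm_sq_gradient_sub_le hW hC hK hKW
  have hlim : Filter.Tendsto (fun k => -inner ℝ (gradient f (x k)) (x (k + 1) - x k))
      Filter.atTop (nhds 0) := by
    -- Armijo bounds `-gᵀs` by `(f (x k) - f (x (k + 1))) / μ`, and the values converge.
    have hbdd : BddBelow (Set.range fun k => f (x k)) :=
      ⟨m, by rintro _ ⟨k, rfl⟩; exact hm.1 ⟨x k, hxU k, rfl⟩⟩
    have h1 := tendsto_atTop_ciInf hanti hbdd
    have h2 := (h1.sub (h1.comp (Filter.tendsto_add_atTop_nat 1))).div_const μ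
    rw [sub_self, zero_div] at h2
    refine squeeze_zero (fun k => (hdesc k).le) (fun k => ?_) h2
    rw [le_div_iff₀ hμ]
    simp only [Function.comp]
    linarith [(hstep k).2.1]
  have hsmall : ∀ ε > 0, ∃ z ∈ K, ‖gradient h z‖ < ε := by
    intro ε hε
    obtain ⟨k, hk⟩ := exists_norm_lt_of_bfgs hH₀ (L := L) hν (fun k => (hdiff k).2)
      (fun k => (hstep k).1) (fun k => (hstep k).2.2)
      (fun k => by simpa only [hgrad] using hL _ (hxK k) _ (hxK (k + 1))) hlim hε
    exact ⟨x k, hxK k, by rwa [hgrad]⟩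
  have hGc : ContinuousOn (gradient h) K := by
    have h1 : ContinuousOn (fderiv ℝ h) W := hC.continuousOn_fderiv_of_isOpen hW (by norm_num)
    exact (InnerProductSpace.toDual ℝ _).symm.continuous.comp_continuousOn (h1.mono hKW)
  obtain ⟨z, hz, hz0⟩ := exists_eq_zero_of_forall_exists_norm_lt hK ⟨_, hxK 0⟩ hGc hsmall
  have hhmin : ∀ w ∈ W, h z ≤ h w := by
    intro w hw
    have hd : DifferentiableAt ℝ h z :=
      (hC.differentiableOn (by norm_num)).differentiableAt (hW.mem_nhds (hKW hz))
    have h1 := hh.fderiv_sub_le (hKW hz) hw hd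
    rw [← inner_gradient_left, hz0, inner_zero_left] at h1
    linarith
  have hloc : IsLocalMin f z := by
    filter_upwards [hev z hz, hW.mem_nhds (hKW hz)] with w hw hwW
    rw [← hw, ← (hev z hz).eq_of_nhds]
    exact hhmin w hwW
  have hmin : IsMinOn f U z := IsMinOn.of_isLocalMinOn_of_convexOn (hKU hz) (hloc.on U) hf
  have hleast : IsLeast (f '' U) (f z) := by
    refine ⟨⟨z, hKU hz, rfl⟩, ?_⟩
    rintro _ ⟨w, hw, rfl⟩
    exact hmin hw
  obtain rfl : f z = m := hleast.isGLB.unique hm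
  exact ⟨hleast, tendsto_of_antitone_of_mem_closure hanti hz
    (hfc.continuousAt (hU.mem_nhds (hKU hz))) fun k => hmin (hxU k)⟩
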